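/- For a linear subspace $V\subset\mathbb R^3$ let $\pi_V:\mathbb R^3\to V$ be the orthogonal projection, and let $G(2,3)$ be the space of $2$-dimensional linear subspaces of $\mathbb R^3$ with the metric $d(V,W)=\|\pi_V-\pi_W\|$ (operator norm). Write $\dim$ for Hausdorff dimension. For real numbers $a,s$ with $0<s<\min\{2,a\}$ and $a\le 3$ put $$T(a,s):=\sup_{A}\ \dim\big(\{V\in G(2,3):\dim(\pi_V(A))<s\}\big),$$ where the supremum is over all Borel sets $A\subset\mathbb R^3$ with $\dim A=a$. Then: 1. If $a\le 1$, then $T(a,s)\ge\max\{0,2s-a\}$. 2. If $1<a\le 2$, then $$T(a,s)\ge\begin{cases}0,& s\le \frac a2,\\ 2s-a,& \frac a2<s\le 1,\\ 1,& 1<s\le\frac{a+1}2,\\ 2s-a,&\frac{a+1}2<s<a.\end{cases}$$ 3. If $2<a\le 3$, then $$T(a,s)\ge\begin{cases}0,& s\le a-1,\\ 1,& a-1<s\le\frac{a+1}2,\\ 2s-a,&\frac{a+1}2<s<2.\end{cases}$$ -/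

import Mathlib

open MeasureTheory
open scoped ENNReal

noncomputable section

/-- The Grassmannian `G(k, n)` of `k`-dimensional linear subspaces of Euclidean space `ℝⁿ`. -/
def RealGrassmannian (k n : ℕ) : Type :=
  {V : Submodule ℝ (EuclideanSpace ℝ (Fin n)) // Module.finrank ℝ V = k}

namespace RealGrassmannian

/-- The orthogonal projection `π_V : ℝⁿ → V ⊆ ℝⁿ`, as a continuous linear endomorphism of `ℝⁿ`. -/
def proj {k n : ℕ} (V : RealGrassmannian k n) :
    EuclideanSpace ℝ (Fin n) →L[ℝ] EuclideanSpace ℝ (Fin n) :=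
  V.1.starProjection

theorem proj_injective (k n : ℕ) :
    Function.Injective (proj : RealGrassmannian k n → _) := by
  intro V W h
  exact Subtype.ext (Submodule.starProjection_inj.mp h)

/-- The standard metric `d(V, W) = ‖π_V - π_W‖` (operator norm) on the Grassmannian. -/
instance (k n : ℕ) : MetricSpace (RealGrassmannian k n) :=
  MetricSpace.induced proj (proj_injective k n) inferInstance

theorem dist_eq {k n : ℕ} (V W : RealGrassmannian k n) : dist V W = ‖proj V - proj W‖ :=
  dist_eq_norm (proj V) (proj W)

end RealGrassmannian

/-- The exceptional set `E_s(A) = {V ∈ G(k, n) : dim π_V(A) < s}`, with `dim` the Hausdorff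
dimension. -/
def exceptionalSet (k n : ℕ) (s : ℝ) (A : Set (EuclideanSpace ℝ (Fin n))) :
    Set (RealGrassmannian k n) :=
  {V | dimH (V.proj '' A) < ENNReal.ofReal s}

/-- `T(a, s)`: the supremum of `dim E_s(A)` over all Borel sets `A ⊆ ℝⁿ` with `dim A = a`. -/
def exceptionalDim (k n : ℕ) (a s : ℝ) : ℝ≥0∞ :=
  ⨆ (A : Set (EuclideanSpace ℝ (Fin n))) (_ : MeasurableSet A)
    (_ : dimH A = ENNReal.ofReal a), dimH (exceptionalSet k n s A)

end

open Set Metric Filter Topology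
open scoped NNReal

/-! Each nontrivial bound comes from one product set `X × Y × Z`. The plane orthogonal to `(u, v,
1)` sees it only through the sheared set of points `(x - u z, y - v z)`, so if the sets `X - u Z`
and `Y - v Z` are small for all `u ∈ U`, `v ∈ W`, then `U × W` embeds in the exceptional set
(`le_exceptionalDim_of_prod`).

The main building block has arithmetic structure. Let `Y`, `Z`, `W` be digit sets of dimensions `t`,
`b - t`, `2t - b`, lying at sparse scales `δ` within about `δ` of lattices of spacing roughly `δ^t`,
`δ^(b-t)`, `δ^(2t-b)`. The last two spacings multiply to `δ^t`, so `Y - v Z` still lies near a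
lattice of spacing about `δ^t` and has dimension at most `t` for each `v ∈ W`
(`boxDimLE_sub_mul_sparseSet`). Taking `X = U = {0}`, or `X = U = [0, 1]`, gives `2t - a`; intervals
and singletons give the bound `1`. Then `t` increases to `s`.

Dimensions of products must be exact. Upper bounds add because all factors are covered at the same
scales (`BoxDimLE.prod`); lower bounds add because each factor is charted by `[0, 1)` with Hölder
inverse (`HasHolderChart.add_dimH_le`). -/

/-! ### Lower bounds for the Hausdorff dimension of products. -/

/-- `S` carries a partial parametrization by `[0, 1)` whose inverse is Hölder of exponent `p`. -/
def HasHolderChart {X : Type*} [PseudoEMetricSpace X] (p : ℝ) (S : Set X) : Prop :=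
  ∃ (g : ℝ → X) (c : ℝ≥0), (∀ u ∈ Ico (0 : ℝ) 1, g u ∈ S) ∧
    ∀ u ∈ Ico (0 : ℝ) 1, ∀ w ∈ Ico (0 : ℝ) 1, edist u w ≤ c * edist (g u) (g w) ^ p

/-- If `S` has a Hölder chart of exponent `p`, then `S × E` has `(p + d)`-dimensional Hausdorff
measure zero only if `E` has `d`-dimensional Hausdorff measure zero. -/
theorem HasHolderChart.hausdorffMeasure_eq_zero {X Y : Type*} [MetricSpace X] [MetricSpace Y]
    [MeasurableSpace Y] [BorelSpace Y] [MeasurableSpace (X × Y)] [BorelSpace (X × Y)]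
    {p d : ℝ} (hp : 0 ≤ p) (hd : 0 ≤ d) {S : Set X} (hS : HasHolderChart p S) {E : Set Y}
    (h0 : μH[p + d] (S ×ˢ E) = 0) : μH[d] E = 0 := by
  obtain ⟨g, c, hgS, hg⟩ := hS
  rw [Measure.hausdorffMeasure_apply] at h0 ⊢
  simp only [ENNReal.iSup_eq_zero] at h0 ⊢
  intro r hr
  have h0r := h0 r hr
  have key : ∀ ε : ℝ≥0, 0 < ε →
      (⨅ (t : ℕ → Set Y) (_ : E ⊆ ⋃ n, t n) (_ : ∀ n, ediam (t n) ≤ r),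
          ∑' n, ⨆ _ : (t n).Nonempty, ediam (t n) ^ d) ≤ c * ε := by
    intro ε hε
    have hlt : (⨅ (t : ℕ → Set (X × Y)) (_ : S ×ˢ E ⊆ ⋃ n, t n) (_ : ∀ n, ediam (t n) ≤ r),
          ∑' n, ⨆ _ : (t n).Nonempty, ediam (t n) ^ (p + d)) < ε := by
      rw [h0r]; exact_mod_cast hε
    simp only [iInf_lt_iff] at hlt
    obtain ⟨t, hcov, hdiam, hsum⟩ := hlt
    -- `J n` holds the parameters whose slice meets `t n`. Its length is at most `c * diam ^ p`, so
    -- averaging the `d`-sums of the slices over `u` costs at most `c` times the `(p + d)`-sum of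
    -- the cover; some slice does as well as the average.
    set J : ℕ → Set ℝ := fun n => {u | u ∈ Ico (0 : ℝ) 1 ∧ ∃ y, (g u, y) ∈ t n} with hJ
    have hJvol : ∀ n, volume (J n) ≤ c * ⨆ _ : (t n).Nonempty, ediam (t n) ^ p := by
      intro n
      refine (Real.volume_le_diam _).trans (ediam_le ?_)
      rintro u ⟨hu, y, huy⟩ w ⟨hw, z, hwz⟩
      refine (hg u hu w hw).trans ?_
      gcongr
      have hne : (t n).Nonempty := ⟨_, huy⟩
      simp only [hne, iSup_pos]
      refine ENNReal.rpow_le_rpow ?_ hp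
      exact (le_max_left _ _).trans (edist_le_ediam_of_mem huy hwz)
    set T : ℕ → Set ℝ := fun n => toMeasurable volume (J n)
    set a : ℕ → ℝ≥0∞ := fun n => ⨆ _ : (t n).Nonempty, ediam (t n) ^ d with ha
    set F : ℝ → ℝ≥0∞ := fun u => ∑' n, (T n).indicator (fun _ => a n) u with hF
    have hFm : Measurable F :=
      Measurable.tsum fun n => measurable_const.indicator (measurableSet_toMeasurable _ _)
    have hint : ∫⁻ u in Ico (0 : ℝ) 1, F u ≤ c * ε := by
      rw [hF, lintegral_tsum
        fun n => (measurable_const.indicator (measurableSet_toMeasurable _ _)).aemeasurable]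
      calc ∑' n, ∫⁻ u in Ico (0 : ℝ) 1, (T n).indicator (fun _ => a n) u
          ≤ ∑' n, c * ⨆ _ : (t n).Nonempty, ediam (t n) ^ (p + d) := by
            refine ENNReal.tsum_le_tsum fun n => ?_
            calc ∫⁻ u in Ico (0 : ℝ) 1, (T n).indicator (fun _ => a n) u
                ≤ ∫⁻ u, (T n).indicator (fun _ => a n) u := setLIntegral_le_lintegral _ _
              _ = a n * volume (J n) := by
                rw [lintegral_indicator_const (measurableSet_toMeasurable _ _),
                  measure_toMeasurable]
              _ ≤ a n * (c * ⨆ _ : (t n).Nonempty, ediam (t n) ^ p) := by gcongr; exact hJvol n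
              _ ≤ _ := by
                by_cases hne : (t n).Nonempty
                · simp only [ha, hne, iSup_pos]
                  rw [ENNReal.rpow_add_of_nonneg p d hp hd, ← mul_assoc, mul_comm _ (c : ℝ≥0∞),
                    mul_assoc, mul_comm (_ ^ d)]
                · simp [ha, hne]
        _ = c * ∑' n, ⨆ _ : (t n).Nonempty, ediam (t n) ^ (p + d) := ENNReal.tsum_mul_left
        _ ≤ c * ε := by gcongr
    have hex : ∃ u ∈ Ico (0 : ℝ) 1, F u ≤ c * ε := by
      by_contra! hcon
      have hlt : ∫⁻ _ in Ico (0 : ℝ) 1, (c * ε : ℝ≥0∞) < ∫⁻ u in Ico (0 : ℝ) 1, F u := by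
        refine setLIntegral_strict_mono measurableSet_Ico (by simp) hFm ?_ ?_
        · simp
          exact ENNReal.mul_ne_top (by simp) (by simp)
        · exact ae_of_all _ fun u hu => hcon u hu
      simp at hlt
      exact absurd hint (not_le.mpr hlt)
    obtain ⟨u, hu, hFu⟩ := hex
    refine le_trans ?_ hFu
    refine iInf_le_of_le (fun n => {y | (g u, y) ∈ t n}) ?_
    have hdle : ∀ n, ediam {y | (g u, y) ∈ t n} ≤ ediam (t n) := fun n =>
      ediam_le fun y hy z hz =>
        (le_max_right _ _).trans (edist_le_ediam_of_mem (x := (g u, y)) (y := (g u, z)) hy hz)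
    refine iInf_le_of_le ?_ (iInf_le_of_le (fun n => (hdle n).trans (hdiam n)) ?_)
    · intro y hy
      have := hcov (show (g u, y) ∈ S ×ˢ E from ⟨hgS u hu, hy⟩)
      simpa using this
    · refine ENNReal.tsum_le_tsum fun n => iSup_le ?_
      rintro ⟨y, hy⟩
      have huT : u ∈ T n := subset_toMeasurable _ _ ⟨hu, y, hy⟩
      have hne : (t n).Nonempty := ⟨_, hy⟩
      simp only [indicator_of_mem huT, ha, hne, iSup_pos]
      exact ENNReal.rpow_le_rpow (hdle n) hd
  refine le_antisymm (le_of_forall_pos_le_add ?_) zero_le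
  intro ε hε
  rw [zero_add]
  obtain ⟨ε', hε', hle⟩ : ∃ ε' : ℝ≥0, 0 < ε' ∧ (c * ε' : ℝ≥0∞) ≤ ε := by
    obtain ⟨η, hη, hηε⟩ := ENNReal.lt_iff_exists_nnreal_btwn.1 hε
    refine ⟨η / (c + 1), div_pos (by exact_mod_cast hη) (by positivity), ?_⟩
    refine le_trans ?_ hηε.le
    rw [← ENNReal.coe_mul, ENNReal.coe_le_coe, mul_div_assoc', div_le_iff₀ (by positivity),
      mul_comm]
    gcongr
    simp
  exact (key ε' hε').trans hle

theorem HasHolderChart.add_dimH_le {X Y : Type*} [MetricSpace X] [MetricSpace Y]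
    {p : ℝ} (hp : 0 ≤ p) {S : Set X} (hS : HasHolderChart p S) {E : Set Y} (hE : E.Nonempty) :
    ENNReal.ofReal p + dimH E ≤ dimH (S ×ˢ E) := by
  borelize Y (X × Y)
  have key : ∀ d : ℝ≥0, μH[d] E ≠ 0 → ENNReal.ofReal p + d ≤ dimH (S ×ˢ E) := by
    intro d hd
    have h := le_dimH_of_hausdorffMeasure_ne_zero (d := p.toNNReal + d) (s := S ×ˢ E) <| by
      rw [NNReal.coe_add, Real.coe_toNNReal _ hp]
      exact fun h => hd (hS.hausdorffMeasure_eq_zero hp d.2 h)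
    simpa [ENNReal.ofReal] using h
  obtain ⟨y, hy⟩ := hE
  have hp' : ENNReal.ofReal p ≤ dimH (S ×ˢ E) := by
    -- The case `d = 0`, where nonemptiness of `E` enters, makes the truncated subtraction below
    -- legitimate.
    have h0 : μH[((0 : ℝ≥0) : ℝ)] E ≠ 0 := by
      have := measure_mono (μ := μH[(0 : ℝ)]) (singleton_subset_iff.2 hy)
      rw [Measure.hausdorffMeasure_zero_singleton] at this
      exact (lt_of_lt_of_le one_pos (by simpa using this)).ne'
    simpa using key 0 h0
  refine add_le_of_le_tsub_left_of_le hp' (dimH_le fun d hd => ?_)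
  exact ENNReal.le_sub_of_add_le_left (by simp) (key d (by simp [hd]))

theorem HasHolderChart.nonempty {X : Type*} [PseudoEMetricSpace X] {p : ℝ} {S : Set X}
    (hS : HasHolderChart p S) : S.Nonempty :=
  let ⟨_, _, hg, _⟩ := hS
  ⟨_, hg 0 (by simp)⟩

theorem HasHolderChart.le_dimH {X : Type*} [MetricSpace X]
    {p : ℝ} (hp : 0 ≤ p) {S : Set X} (hS : HasHolderChart p S) : ENNReal.ofReal p ≤ dimH S := by
  have h := hS.add_dimH_le hp (singleton_nonempty (0 : ℝ))
  rw [dimH_singleton, add_zero] at h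
  refine h.trans ?_
  have h2 := (Isometry.dimH_image (f := fun x : X => (x, (0 : ℝ)))
    (Isometry.of_dist_eq fun x y => by simp [Prod.dist_eq]) S)
  rw [← h2]
  refine dimH_mono ?_
  rintro ⟨x, y⟩ ⟨hx, hy⟩
  have hy0 : y = 0 := hy
  exact ⟨x, hx, by rw [hy0]⟩

theorem hasHolderChart_singleton {X : Type*} [PseudoEMetricSpace X] (x : X) :
    HasHolderChart 0 ({x} : Set X) := by
  refine ⟨fun _ => x, 1, fun _ _ => rfl, fun u hu w hw => ?_⟩
  simp only [ENNReal.rpow_zero, mul_one, ENNReal.coe_one]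
  rw [edist_dist, Real.dist_eq, ← ENNReal.ofReal_one]
  refine ENNReal.ofReal_le_ofReal (abs_le.2 ⟨?_, ?_⟩) <;> linarith [hu.1, hu.2, hw.1, hw.2]

theorem hasHolderChart_Icc : HasHolderChart 1 (Icc (0 : ℝ) 1) :=
  ⟨id, 1, fun _ hu => Ico_subset_Icc_self hu, fun u _ w _ => by simp⟩

/-! ### Upper bounds by counting along a sequence of scales. -/

/-- `d` bounds the box dimension of `S` along the scales `2 ^ (-N k)`. -/
def BoxDimLE {X : Type*} [PseudoMetricSpace X] (N : ℕ → ℕ) (S : Set X) (d : ℝ) : Prop :=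
  ∃ C : ℝ, ∀ ε > 0, ∀ᶠ k in atTop, ∃ F : Finset X,
    (F.card : ℝ) ≤ 2 ^ ((d + ε) * N k) ∧ S ⊆ ⋃ x ∈ F, closedBall x (C * 2 ^ (-N k : ℝ))

theorem BoxDimLE.mono_set {X : Type*} [PseudoMetricSpace X] {N : ℕ → ℕ} {S T : Set X} {d : ℝ}
    (hT : BoxDimLE N T d) (h : S ⊆ T) : BoxDimLE N S d := by
  obtain ⟨C, hC⟩ := hT
  refine ⟨C, fun ε hε => ?_⟩
  filter_upwards [hC ε hε] with k ⟨F, hF, hTF⟩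
  exact ⟨F, hF, h.trans hTF⟩

theorem BoxDimLE.prod {X Y : Type*} [PseudoMetricSpace X] [PseudoMetricSpace Y] {N : ℕ → ℕ}
    {S : Set X} {T : Set Y} {d e : ℝ} (hS : BoxDimLE N S d) (hT : BoxDimLE N T e) :
    BoxDimLE N (S ×ˢ T) (d + e) := by
  obtain ⟨C, hC⟩ := hS
  obtain ⟨D, hD⟩ := hT
  refine ⟨max C D, fun ε hε => ?_⟩
  filter_upwards [hC (ε / 2) (half_pos hε), hD (ε / 2) (half_pos hε)] with k ⟨F, hF, hSF⟩ ⟨G, hG, hTG⟩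
  refine ⟨F ×ˢ G, ?_, ?_⟩
  · rw [Finset.card_product, Nat.cast_mul,
      show (d + e + ε) * N k = (d + ε / 2) * N k + (e + ε / 2) * N k by ring,
      Real.rpow_add two_pos]
    gcongr
  · rintro ⟨x, y⟩ ⟨hx, hy⟩
    obtain ⟨a, ha, hxa⟩ := mem_iUnion₂.1 (hSF hx)
    obtain ⟨b, hb, hyb⟩ := mem_iUnion₂.1 (hTG hy)
    refine mem_iUnion₂.2 ⟨(a, b), Finset.mem_product.2 ⟨ha, hb⟩, ?_⟩
    rw [← closedBall_prod_same]
    exact ⟨closedBall_subset_closedBall (by gcongr; exact le_max_left _ _) hxa,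
      closedBall_subset_closedBall (by gcongr; exact le_max_right _ _) hyb⟩

theorem BoxDimLE.dimH_le {X : Type*} [MetricSpace X] {N : ℕ → ℕ} (hN : Tendsto N atTop atTop)
    {S : Set X} {d : ℝ} (hd : 0 ≤ d) (hS : BoxDimLE N S d) : dimH S ≤ ENNReal.ofReal d := by
  borelize X
  obtain ⟨C, hC⟩ := hS
  have hN' : Tendsto (fun k => (2 : ℝ) ^ (-N k : ℝ)) atTop (𝓝 0) := by
    have h1 : Tendsto (fun k => ((1 / 2 : ℝ)) ^ N k) atTop (𝓝 0) :=
      (tendsto_pow_atTop_nhds_zero_of_lt_one (by norm_num) (by norm_num)).comp hN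
    refine h1.congr fun k => ?_
    rw [Real.rpow_neg two_pos.le, Real.rpow_natCast, one_div, inv_pow]
  -- Bounds ball diameters; `max` is needed because `C` may be negative.
  set B : ℝ := 2 * max C 0 with hB
  have hB0 : 0 ≤ B := by positivity
  have key : ∀ ε : ℝ≥0, 0 < ε → dimH S ≤ ENNReal.ofReal d + ε := by
    intro ε hε
    have hε' : (0 : ℝ) < ε := hε
    have hfin : μH[d + ε] S ≤ ENNReal.ofReal (B ^ (d + ε)) := by
      have hev := hC ε hε'
      choose! F hF using fun k (hk : ∃ F : Finset X, (F.card : ℝ) ≤ 2 ^ ((d + ε) * N k) ∧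
        S ⊆ ⋃ x ∈ F, closedBall x (C * 2 ^ (-N k : ℝ))) => hk
      have hdiam : ∀ k (i : F k), ediam (closedBall (i : X) (C * 2 ^ (-N k : ℝ)))
          ≤ ENNReal.ofReal (B * 2 ^ (-N k : ℝ)) := by
        intro k i
        refine ediam_le fun x hx y hy => ?_
        rw [edist_dist]
        refine ENNReal.ofReal_le_ofReal ?_
        have h1 : dist x y ≤ 2 * (C * 2 ^ (-N k : ℝ)) := by
          have := dist_triangle_right x y (i : X)
          rw [mem_closedBall] at hx hy
          linarith
        refine h1.trans ?_
        rw [hB, mul_assoc]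
        gcongr
        exact le_max_left _ _
      refine (Measure.hausdorffMeasure_le_liminf_sum (l := atTop) (d + ε) S
        (fun k => ENNReal.ofReal (B * 2 ^ (-N k : ℝ))) ?_
        (fun k (i : F k) => closedBall (i : X) (C * 2 ^ (-N k : ℝ)))
        (Eventually.of_forall fun k i => hdiam k i) ?_).trans ?_
      · rw [← ENNReal.ofReal_zero]
        refine ENNReal.tendsto_ofReal ?_
        simpa using hN'.const_mul B
      · filter_upwards [hev] with k hk
        refine (hF k hk).2.trans ?_
        simp [iUnion_subtype]
      · refine liminf_le_of_le (by isBoundedDefault) ?_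
        intro b hb
        obtain ⟨k, hk, hkb⟩ := (hev.and hb).exists
        refine hkb.trans ?_
        calc ∑ i : F k, ediam (closedBall (i : X) (C * 2 ^ (-N k : ℝ))) ^ (d + ε : ℝ)
            ≤ ∑ _i : F k, ENNReal.ofReal (B * 2 ^ (-N k : ℝ)) ^ (d + ε : ℝ) := by
              gcongr with i
              exact hdiam k i
          _ = ENNReal.ofReal ((F k).card * (B * 2 ^ (-N k : ℝ)) ^ (d + ε : ℝ)) := by
              rw [Finset.sum_const, nsmul_eq_mul, Finset.card_univ, Fintype.card_coe,
                ENNReal.ofReal_rpow_of_nonneg (by positivity) (by positivity),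
                ENNReal.ofReal_mul (by positivity), ENNReal.ofReal_natCast]
          _ ≤ ENNReal.ofReal (2 ^ ((d + ε) * N k) * (B * 2 ^ (-N k : ℝ)) ^ (d + ε : ℝ)) := by
              gcongr
              exact (hF k hk).1
          _ = ENNReal.ofReal (B ^ (d + ε : ℝ)) := by
              rw [Real.mul_rpow hB0 (by positivity), ← Real.rpow_mul two_pos.le, mul_left_comm,
                ← Real.rpow_add two_pos]
              ring_nf
              simp
    have h := dimH_le_of_hausdorffMeasure_ne_top (d := d.toNNReal + ε) (s := S) <| by
      rw [NNReal.coe_add, Real.coe_toNNReal _ hd]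
      exact (hfin.trans_lt ENNReal.ofReal_lt_top).ne
    simpa [ENNReal.ofReal] using h
  refine ENNReal.le_of_forall_pos_le_add fun ε hε _ => key ε hε

/-- A bounded set of reals close to the lattices `2 ^ (-a k) ℤ` at scale `2 ^ (-N k)`. -/
theorem boxDimLE_of_lattice {N : ℕ → ℕ} (hN : Tendsto N atTop atTop) {S : Set ℝ} {d B C : ℝ}
    (hS : ∀ x ∈ S, |x| ≤ B) (a : ℕ → ℕ)
    (hx : ∀ x ∈ S, ∀ k, ∃ i : ℤ, |x - i / 2 ^ a k| ≤ C * 2 ^ (-N k : ℝ))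
    (ha : ∀ ε > 0, ∀ᶠ k in atTop, (a k : ℝ) ≤ (d + ε) * N k) : BoxDimLE N S d := by
  refine ⟨C, fun ε hε => ?_⟩
  -- The relevant lattice points lie in `[-Q, Q]`; the factor `2Q + 1` in their number is absorbed
  -- by half of `ε`.
  obtain ⟨Q, hQ⟩ := exists_nat_ge (|B| + |C|)
  have hbig : ∀ᶠ k in atTop, ((2 * Q + 1 : ℕ) : ℝ) ≤ 2 ^ (ε / 2 * N k) := by
    have h1 : Tendsto (fun k => ε / 2 * (N k : ℝ)) atTop atTop :=
      (tendsto_natCast_atTop_atTop.comp hN).const_mul_atTop (half_pos hε)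
    exact ((tendsto_rpow_atTop_of_base_gt_one 2 one_lt_two).comp h1).eventually_ge_atTop _
  filter_upwards [ha (ε / 2) (half_pos hε), hbig] with k hk hkQ
  refine ⟨(Finset.Icc (-(Q * 2 ^ a k : ℤ)) (Q * 2 ^ a k)).image (fun i : ℤ => (i : ℝ) / 2 ^ a k),
    ?_, ?_⟩
  · calc _ ≤ (((Finset.Icc (-(Q * 2 ^ a k : ℤ)) (Q * 2 ^ a k)).card : ℕ) : ℝ) := by
          exact_mod_cast Finset.card_image_le
      _ ≤ ((2 * Q + 1) * 2 ^ a k : ℕ) := by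
          rw [Int.card_Icc]
          norm_cast
          rw [Int.toNat_le]
          push_cast
          have : (1 : ℤ) ≤ 2 ^ a k := one_le_pow₀ (by norm_num)
          linarith
      _ = ((2 * Q + 1 : ℕ) : ℝ) * 2 ^ (a k : ℝ) := by push_cast; rw [Real.rpow_natCast]
      _ ≤ 2 ^ (ε / 2 * N k) * 2 ^ ((d + ε / 2) * N k) := by
          gcongr
          norm_num
      _ = 2 ^ ((d + ε) * N k) := by
          rw [← Real.rpow_add two_pos]; ring_nf
  · intro x hxS
    obtain ⟨i, hi⟩ := hx x hxS k
    refine mem_iUnion₂.2 ⟨(i : ℝ) / 2 ^ a k, Finset.mem_image.2 ⟨i, ?_, rfl⟩, ?_⟩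
    · have h2 : (0 : ℝ) < 2 ^ a k := by positivity
      have hle : (2 : ℝ) ^ (-N k : ℝ) ≤ 1 :=
        Real.rpow_le_one_of_one_le_of_nonpos one_le_two (by simp)
      have h3 : |(i : ℝ) / 2 ^ a k| ≤ Q := by
        have h4 : C * 2 ^ (-N k : ℝ) ≤ |C| := by
          calc C * 2 ^ (-N k : ℝ) ≤ |C| * 2 ^ (-N k : ℝ) := by gcongr; exact le_abs_self C
            _ ≤ |C| * 1 := by gcongr
            _ = |C| := mul_one _
        have h5 := abs_sub_abs_le_abs_sub ((i : ℝ) / 2 ^ a k) x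
        rw [abs_sub_comm] at h5
        linarith [hS x hxS, le_abs_self B]
      rw [abs_div, abs_of_pos h2, div_le_iff₀ h2] at h3
      rw [Finset.mem_Icc, ← abs_le]
      exact_mod_cast h3
    · rwa [mem_closedBall, Real.dist_eq]

theorem boxDimLE_Icc {N : ℕ → ℕ} (hN : Tendsto N atTop atTop) (a b : ℝ) :
    BoxDimLE N (Icc a b) 1 := by
  refine boxDimLE_of_lattice hN (B := max |a| |b|) (C := 1)
    (fun x hx => abs_le_max_abs_abs hx.1 hx.2) N (fun x _ k => ⟨⌊x * 2 ^ N k⌋, ?_⟩)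
    fun ε hε => Eventually.of_forall fun k => ?_
  · have h2 : (0 : ℝ) < 2 ^ N k := by positivity
    rw [Real.rpow_neg two_pos.le, Real.rpow_natCast, one_mul, sub_div' h2.ne', abs_div,
      abs_of_pos h2, div_eq_mul_inv]
    refine mul_le_of_le_one_left (by positivity) ?_
    rw [Int.self_sub_floor, abs_of_nonneg (Int.fract_nonneg _)]
    exact (Int.fract_lt_one _).le
  · have := mul_nonneg hε.le (Nat.cast_nonneg (α := ℝ) (N k))
    linarith

theorem boxDimLE_singleton {N : ℕ → ℕ} : BoxDimLE N ({0} : Set ℝ) 0 := by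
  refine ⟨0, fun ε hε => Eventually.of_forall fun k => ⟨{0}, ?_, by simp⟩⟩
  simp only [Finset.card_singleton, Nat.cast_one]
  exact Real.one_le_rpow one_le_two (by positivity)

/-! ### Sparse digit sets and their Hölder charts. -/

theorem hasHolderChart_of_sub_le {p : ℝ} (hp : 0 ≤ p) {S : Set ℝ} (g : ℝ → ℝ) (c : ℝ≥0)
    (hgS : ∀ u ∈ Ico (0 : ℝ) 1, g u ∈ S)
    (hg : ∀ u w, 0 ≤ u → u < w → w < 1 → g u ≤ g w ∧ w - u ≤ (c * (g w - g u)) ^ p) :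
    HasHolderChart p S := by
  refine ⟨g, c ^ p, hgS, ?_⟩
  have key : ∀ u w, 0 ≤ u → u < w → w < 1 → edist u w ≤ (c ^ p : ℝ≥0) * edist (g u) (g w) ^ p := by
    intro u w hu huw hw
    obtain ⟨h1, h2⟩ := hg u w hu huw hw
    have h3 : dist u w = w - u := by rw [dist_comm, Real.dist_eq, abs_of_pos (by linarith)]
    have h4 : dist (g u) (g w) = g w - g u := by
      rw [dist_comm, Real.dist_eq, abs_of_nonneg (by linarith)]
    rw [edist_dist, edist_dist, h3, h4, ENNReal.coe_rpow_of_nonneg _ hp,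
      ← ENNReal.mul_rpow_of_nonneg _ _ hp, ← ENNReal.ofReal_coe_nnreal,
      ← ENNReal.ofReal_mul c.coe_nonneg,
      ENNReal.ofReal_rpow_of_nonneg (mul_nonneg c.coe_nonneg (by linarith)) hp]
    exact ENNReal.ofReal_le_ofReal h2
  intro u hu w hw
  rcases lt_trichotomy u w with h | rfl | h
  · exact key u w hu.1 h hw.2
  · simp
  · rw [edist_comm, edist_comm (g u)]
    exact key w u hw.1 h hu.2

/-- Rapidly increasing scales that leave room for the digits of a set of dimension `p`. -/
structure IsSparseScale (p : ℝ) (N : ℕ → ℕ) : Prop where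
  zero : N 0 = 0
  add_ceil_lt : ∀ k, N k + ⌈p * N (k + 1)⌉₊ + 1 ≤ N (k + 1)
  eventually_le : ∀ ε > (0 : ℝ), ∀ᶠ k in atTop, (N k : ℝ) ≤ ε * N (k + 1)

theorem IsSparseScale.tendsto {p : ℝ} {N : ℕ → ℕ} (h : IsSparseScale p N) :
    Tendsto N atTop atTop :=
  (strictMono_nat_of_lt_succ fun k => by have := h.add_ceil_lt k; omega).tendsto_atTop

/-- Position of the last free binary digit before the scale `N k`. -/
noncomputable def lastDigit (p : ℝ) (N : ℕ → ℕ) : ℕ → ℕ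
  | 0 => 0
  | k + 1 => N k + ⌈p * N (k + 1)⌉₊

/-- Number of free binary digits before the scale `N k`. -/
noncomputable def numDigits (p : ℝ) (N : ℕ → ℕ) : ℕ → ℕ
  | 0 => 0
  | k + 1 => numDigits p N k + ⌈p * N (k + 1)⌉₊

/-- Numbers in `[0, 1]` whose binary digits in the ranges `(lastDigit k, N k]` vanish. -/
noncomputable def sparseSet (p : ℝ) (N : ℕ → ℕ) : Set ℝ :=
  {x | x ∈ Icc (0 : ℝ) 1 ∧ ∀ k, ∃ i : ℤ, x ∈ Icc ((i : ℝ) / 2 ^ lastDigit p N k)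
    ((i : ℝ) / 2 ^ lastDigit p N k + (2 ^ N k)⁻¹)}

theorem measurableSet_sparseSet (p : ℝ) (N : ℕ → ℕ) : MeasurableSet (sparseSet p N) := by
  have : sparseSet p N = Icc (0 : ℝ) 1 ∩ ⋂ k, ⋃ i : ℤ, Icc ((i : ℝ) / 2 ^ lastDigit p N k)
    ((i : ℝ) / 2 ^ lastDigit p N k + (2 ^ N k)⁻¹) := by
    ext x; simp [sparseSet]
  rw [this]
  exact measurableSet_Icc.inter (.iInter fun k => .iUnion fun i => measurableSet_Icc)

/-- Partial sums of the digit-spreading map. -/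
noncomputable def spreadSum (p : ℝ) (N : ℕ → ℕ) (u : ℝ) : ℕ → ℝ
  | 0 => 0
  -- The numerator is the next block of binary digits of `u`, up to position `numDigits p N (k +
  -- 1)`, read as an integer; it is moved to the free positions after `N k`.
  | k + 1 => spreadSum p N u k + (⌊2 ^ numDigits p N (k + 1) * u⌋ -
      2 ^ ⌈p * N (k + 1)⌉₊ * ⌊2 ^ numDigits p N k * u⌋) / 2 ^ lastDigit p N (k + 1)

section spread

variable {p : ℝ} {N : ℕ → ℕ}

theorem IsSparseScale.lastDigit_le (h : IsSparseScale p N) (k : ℕ) : lastDigit p N k ≤ N k := by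
  cases k with
  | zero => simp [lastDigit]
  | succ k => have := h.add_ceil_lt k; simp only [lastDigit]; omega

theorem exists_spreadSum_eq (h : IsSparseScale p N) (u : ℝ) (k : ℕ) :
    ∃ i : ℤ, spreadSum p N u k = i / 2 ^ lastDigit p N k := by
  induction k with
  | zero => exact ⟨0, by simp [spreadSum]⟩
  | succ k ih =>
    obtain ⟨i, hi⟩ := ih
    have hle : lastDigit p N k ≤ lastDigit p N (k + 1) :=
      (h.lastDigit_le k).trans (Nat.le_add_right _ _)
    refine ⟨i * 2 ^ (lastDigit p N (k + 1) - lastDigit p N k) +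
      (⌊2 ^ numDigits p N (k + 1) * u⌋ - 2 ^ ⌈p * N (k + 1)⌉₊ * ⌊2 ^ numDigits p N k * u⌋), ?_⟩
    rw [spreadSum, hi]
    push_cast
    rw [add_div]
    congr 1
    rw [div_eq_div_iff (by positivity) (by positivity), mul_assoc, ← pow_add,
      Nat.sub_add_cancel hle]

theorem floor_digit_bounds (m n : ℕ) (u : ℝ) :
    (0 : ℝ) ≤ ⌊(2 : ℝ) ^ (m + n) * u⌋ - 2 ^ n * ⌊(2 : ℝ) ^ m * u⌋ ∧
    (⌊(2 : ℝ) ^ (m + n) * u⌋ - 2 ^ n * ⌊(2 : ℝ) ^ m * u⌋ : ℝ) ≤ 2 ^ n - 1 := by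
  have e : (2 : ℝ) ^ (m + n) * u = 2 ^ n * (2 ^ m * u) := by ring
  rw [e]
  set y := (2 : ℝ) ^ m * u
  have hn : (0 : ℝ) < 2 ^ n := by positivity
  constructor
  · have h1 : (2 : ℤ) ^ n * ⌊y⌋ ≤ ⌊(2 : ℝ) ^ n * y⌋ := by
      rw [Int.le_floor]; push_cast
      exact mul_le_mul_of_nonneg_left (Int.floor_le y) hn.le
    have : ((2 : ℝ) ^ n * ⌊y⌋) ≤ ⌊(2 : ℝ) ^ n * y⌋ := by exact_mod_cast h1
    linarith
  · have h1 : ⌊(2 : ℝ) ^ n * y⌋ < (2 : ℤ) ^ n * (⌊y⌋ + 1) := by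
      rw [Int.floor_lt]; push_cast
      exact mul_lt_mul_of_pos_left (Int.lt_floor_add_one y) hn
    have h2 : ⌊(2 : ℝ) ^ n * y⌋ + 1 ≤ (2 : ℤ) ^ n * (⌊y⌋ + 1) := h1
    have : (⌊(2 : ℝ) ^ n * y⌋ + 1 : ℝ) ≤ (2 : ℝ) ^ n * (⌊y⌋ + 1) := by exact_mod_cast h2
    linarith

theorem monotone_spreadSum (u : ℝ) : Monotone (spreadSum p N u) := by
  refine monotone_nat_of_le_succ fun k => ?_
  rw [spreadSum]
  exact le_add_of_nonneg_right (div_nonneg (floor_digit_bounds _ _ u).1 (by positivity))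

/-- A full block of ones adds only `2 ^ (-N k) - 2 ^ (-lastDigit p N (k + 1))`, so the intervals are
nested and their common point `spread p N u` has the required zero digits. -/
theorem antitone_spreadSum_add (h : IsSparseScale p N) (u : ℝ) :
    Antitone fun k => spreadSum p N u k + ((2 : ℝ) ^ N k)⁻¹ := by
  refine antitone_nat_of_succ_le fun k => ?_
  have h1 := (floor_digit_bounds (numDigits p N k) ⌈p * N (k + 1)⌉₊ u).2
  have h2 : ((2 : ℝ) ^ N (k + 1))⁻¹ ≤ (2 ^ lastDigit p N (k + 1))⁻¹ :=
    inv_anti₀ (by positivity) (pow_le_pow_right₀ one_le_two (h.lastDigit_le _))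
  have h3 : ((2 : ℝ) ^ ⌈p * N (k + 1)⌉₊ - 1) / 2 ^ lastDigit p N (k + 1)
      = (2 ^ N k)⁻¹ - (2 ^ lastDigit p N (k + 1))⁻¹ := by
    rw [lastDigit, pow_add]; field_simp
  have h4 := div_le_div_of_nonneg_right h1
    (show (0 : ℝ) ≤ 2 ^ lastDigit p N (k + 1) by positivity)
  rw [h3] at h4
  simp only [spreadSum]
  rw [numDigits]
  linarith

/-- The digit-spreading map. -/
noncomputable def spread (p : ℝ) (N : ℕ → ℕ) (u : ℝ) : ℝ := ⨆ k, spreadSum p N u k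

theorem spread_mem_Icc (h : IsSparseScale p N) (u : ℝ) (k : ℕ) :
    spread p N u ∈ Icc (spreadSum p N u k) (spreadSum p N u k + ((2 : ℝ) ^ N k)⁻¹) :=
  mem_iInter.1 ((monotone_spreadSum u).ciSup_mem_iInter_Icc_of_antitone
    (antitone_spreadSum_add h u) fun k => le_add_of_nonneg_right (by positivity)) k

theorem tendsto_spreadSum (h : IsSparseScale p N) (u : ℝ) :
    Tendsto (spreadSum p N u) atTop (𝓝 (spread p N u)) :=
  tendsto_atTop_ciSup (monotone_spreadSum u)
    ⟨spread p N u, by rintro _ ⟨k, rfl⟩; exact (spread_mem_Icc h u k).1⟩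

theorem spread_mem_sparseSet (h : IsSparseScale p N) (u : ℝ) :
    spread p N u ∈ sparseSet p N := by
  refine ⟨?_, fun k => ?_⟩
  · have := spread_mem_Icc h u 0
    simpa [spreadSum, h.zero] using this
  · obtain ⟨i, hi⟩ := exists_spreadSum_eq h u k
    exact ⟨i, hi ▸ spread_mem_Icc h u k⟩

/-- Abel summation turns the spread sum into a combination of floors with positive weights. -/
theorem spreadSum_succ_sub (u : ℝ) (k : ℕ) :
    spreadSum p N u (k + 1) - ⌊2 ^ numDigits p N (k + 1) * u⌋ / 2 ^ lastDigit p N (k + 1) =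
      spreadSum p N u k - ⌊2 ^ numDigits p N k * u⌋ / 2 ^ lastDigit p N k +
        ⌊2 ^ numDigits p N k * u⌋ * ((2 ^ lastDigit p N k)⁻¹ - (2 ^ N k)⁻¹) := by
  rw [spreadSum]
  have : (2 : ℝ) ^ lastDigit p N (k + 1) = 2 ^ N k * 2 ^ ⌈p * N (k + 1)⌉₊ := by
    rw [lastDigit, pow_add]
  rw [this]
  field_simp
  ring

theorem inv_lastDigit_sub_nonneg (h : IsSparseScale p N) (k : ℕ) :
    (0 : ℝ) ≤ (2 ^ lastDigit p N k)⁻¹ - (2 ^ N k)⁻¹ :=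
  sub_nonneg.2 (inv_anti₀ (by positivity) (pow_le_pow_right₀ one_le_two (h.lastDigit_le _)))

theorem floor_mul_mono {m : ℕ} {u w : ℝ} (huw : u ≤ w) :
    (⌊(2 : ℝ) ^ m * u⌋ : ℝ) ≤ ⌊(2 : ℝ) ^ m * w⌋ := by
  exact_mod_cast Int.floor_mono (mul_le_mul_of_nonneg_left huw (by positivity))

/-- By `spreadSum_succ_sub`, the expression is a sum of floors with nonnegative weights, each
monotone in `u`. The initial term vanishes since both points lie in `[0, 1)`. -/
theorem spreadSum_sub_mono (h : IsSparseScale p N) {u w : ℝ} (hu : 0 ≤ u)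
    (huw : u ≤ w) (hw : w < 1) (k : ℕ) :
    spreadSum p N u k - ⌊2 ^ numDigits p N k * u⌋ / 2 ^ lastDigit p N k ≤
      spreadSum p N w k - ⌊2 ^ numDigits p N k * w⌋ / 2 ^ lastDigit p N k := by
  induction k with
  | zero =>
    simp only [spreadSum, numDigits, lastDigit, pow_zero, one_mul, div_one, zero_sub]
    rw [Int.floor_eq_zero_iff.2 ⟨hu, huw.trans_lt hw⟩, Int.floor_eq_zero_iff.2 ⟨hu.trans huw, hw⟩]
  | succ k ih =>
    rw [spreadSum_succ_sub, spreadSum_succ_sub]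
    exact add_le_add ih
      (mul_le_mul_of_nonneg_right (floor_mul_mono huw) (inv_lastDigit_sub_nonneg h k))

theorem le_spread_sub (h : IsSparseScale p N) {u w : ℝ} (hu : 0 ≤ u) (huw : u ≤ w)
    (hw : w < 1) (j : ℕ) :
    (⌊2 ^ numDigits p N j * w⌋ - ⌊2 ^ numDigits p N j * u⌋) *
      ((2 ^ lastDigit p N j)⁻¹ - (2 ^ N j)⁻¹) ≤ spread p N w - spread p N u := by
  refine ge_of_tendsto ((tendsto_spreadSum h w).sub (tendsto_spreadSum h u)) ?_
  -- Only the `j`-th term of the Abel sum is kept, and it first appears in the partial sum of index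
  -- `j + 1`; the others are nonnegative.
  filter_upwards [eventually_ge_atTop (j + 1)] with k hk
  have key : (⌊2 ^ numDigits p N j * w⌋ - ⌊2 ^ numDigits p N j * u⌋) *
      (((2 : ℝ) ^ lastDigit p N j)⁻¹ - (2 ^ N j)⁻¹) ≤
      (spreadSum p N w k - ⌊2 ^ numDigits p N k * w⌋ / 2 ^ lastDigit p N k) -
      (spreadSum p N u k - ⌊2 ^ numDigits p N k * u⌋ / 2 ^ lastDigit p N k) := by
    induction k, hk using Nat.le_induction with
    | base =>
      rw [spreadSum_succ_sub, spreadSum_succ_sub]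
      have := spreadSum_sub_mono h hu huw hw j
      linarith
    | succ k hk ih =>
      rw [spreadSum_succ_sub, spreadSum_succ_sub]
      have := mul_le_mul_of_nonneg_right (floor_mul_mono (m := numDigits p N k) huw)
        (inv_lastDigit_sub_nonneg h k)
      linarith
  have := div_le_div_of_nonneg_right (floor_mul_mono (m := numDigits p N k) huw)
    (show (0 : ℝ) ≤ 2 ^ lastDigit p N k by positivity)
  linarith

theorem half_le_floor_sub {x y : ℝ} (h : 1 ≤ y - x) : (y - x) / 2 ≤ ⌊y⌋ - ⌊x⌋ := by
  have h1 : (⌊x⌋ + ⌊y - x⌋ : ℝ) ≤ ⌊y⌋ := by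
    exact_mod_cast (Int.le_floor_add x (y - x)).trans_eq (by ring_nf)
  have h2 : (1 : ℝ) ≤ ⌊y - x⌋ := by exact_mod_cast Int.le_floor.2 (by simpa using h)
  have h3 := Int.sub_one_lt_floor (y - x)
  linarith

theorem le_four_mul_spread_sub (h : IsSparseScale p N) {u w : ℝ} (hu : 0 ≤ u) (huw : u ≤ w)
    (hw : w < 1) (k : ℕ) (hk : 1 ≤ 2 ^ numDigits p N (k + 1) * (w - u)) :
    2 ^ numDigits p N k / 2 ^ N k * (w - u) ≤ 4 * (spread p N w - spread p N u) := by
  have h1 := le_spread_sub h hu huw hw (k + 1)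
  have h2 : 2 ^ numDigits p N (k + 1) * (w - u) / 2 ≤
      (⌊2 ^ numDigits p N (k + 1) * w⌋ - ⌊2 ^ numDigits p N (k + 1) * u⌋ : ℝ) := by
    rw [mul_sub] at hk ⊢
    exact half_le_floor_sub hk
  -- The extra `+ 1` in `add_ceil_lt` is used here: at least one forced zero makes the weight lose
  -- at most half. With the half lost to floors, this gives the constant `4`.
  have h3 : ((2 : ℝ) ^ lastDigit p N (k + 1))⁻¹ / 2 ≤
      (2 ^ lastDigit p N (k + 1))⁻¹ - (2 ^ N (k + 1))⁻¹ := by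
    have h4 : ((2 : ℝ) ^ N (k + 1))⁻¹ ≤ (2 ^ (lastDigit p N (k + 1) + 1))⁻¹ :=
      inv_anti₀ (by positivity) (pow_le_pow_right₀ one_le_two (h.add_ceil_lt k))
    rw [pow_succ, mul_inv] at h4
    linarith
  have h5 := mul_le_mul h2 h3 (by positivity) (le_trans (by positivity) h2)
  have h6 : 2 ^ numDigits p N (k + 1) * (w - u) / 2 * (((2 : ℝ) ^ lastDigit p N (k + 1))⁻¹ / 2)
      = 2 ^ numDigits p N k / 2 ^ N k * (w - u) / 4 := by
    rw [lastDigit, numDigits, pow_add, pow_add]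
    field_simp
    ring
  rw [h6] at h5
  linarith

theorem mul_le_numDigits (h : IsSparseScale p N) (k : ℕ) : p * N k ≤ numDigits p N k := by
  cases k with
  | zero => simp [h.zero, numDigits]
  | succ k =>
    rw [numDigits]
    push_cast
    have := Nat.le_ceil (p * N (k + 1))
    have h0 : (0 : ℝ) ≤ numDigits p N k := Nat.cast_nonneg _
    linarith

theorem tendsto_numDigits (h : IsSparseScale p N) (hp : 0 < p) :
    Tendsto (numDigits p N) atTop atTop := by
  refine (strictMono_nat_of_lt_succ fun k => ?_).tendsto_atTop
  have h1 : 0 < N (k + 1) := by have := h.add_ceil_lt k; omega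
  have h2 : 0 < ⌈p * N (k + 1)⌉₊ := Nat.ceil_pos.2 (by positivity)
  rw [numDigits]
  omega

/-- Take the first digit count `numDigits p N (k + 1)` that separates `u` and `w`, and put `τ = w -
u`, `m = numDigits p N k`. The gap of the images is at least `2 ^ (m - N k) * τ / 4`. Since `τ < 2 ^
(-m)`, writing `τ = τ ^ (1 - p) * τ ^ p` reduces the claim to `p * N k ≤ m`. -/
theorem hasHolderChart_sparseSet (h : IsSparseScale p N) (hp : 0 < p) (hp1 : p ≤ 1) :
    HasHolderChart p (sparseSet p N) := by
  refine hasHolderChart_of_sub_le hp.le (spread p N) 4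
    (fun u _ => spread_mem_sparseSet h u) fun u w hu huw hw => ?_
  have hτ : 0 < w - u := sub_pos.2 huw
  have hex : ∃ j, 1 ≤ 2 ^ numDigits p N j * (w - u) := by
    have h1 : Tendsto (fun j => (2 : ℝ) ^ numDigits p N j * (w - u)) atTop atTop :=
      ((tendsto_pow_atTop_atTop_of_one_lt one_lt_two).comp
        (tendsto_numDigits h hp)).atTop_mul_const hτ
    exact (h1.eventually_ge_atTop 1).exists
  classical
  obtain ⟨k, hk⟩ : ∃ k, Nat.find hex = k + 1 := by
    refine Nat.exists_eq_succ_of_ne_zero fun h0 => ?_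
    have := Nat.find_spec hex
    rw [h0, numDigits] at this
    linarith
  have hk1 : 1 ≤ 2 ^ numDigits p N (k + 1) * (w - u) := hk ▸ Nat.find_spec hex
  have hk0 : 2 ^ numDigits p N k * (w - u) < 1 := not_le.1 (Nat.find_min hex (by omega))
  have hgap := le_four_mul_spread_sub h hu huw.le hw k hk1
  refine ⟨by
    have : 0 ≤ 2 ^ numDigits p N k / 2 ^ N k * (w - u) := by positivity
    linarith, ?_⟩
  set τ := w - u
  set m := numDigits p N k
  refine le_trans ?_ (Real.rpow_le_rpow (by positivity) hgap hp.le)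
  have hm : (2 : ℝ) ^ m / 2 ^ N k = 2 ^ ((m : ℝ) - N k) := by
    rw [Real.rpow_sub two_pos, Real.rpow_natCast, Real.rpow_natCast]
  have hτm : τ ≤ 2 ^ (-m : ℝ) := by
    rw [Real.rpow_neg two_pos.le, Real.rpow_natCast, ← one_div, le_div_iff₀ (by positivity)]
    linarith
  calc τ = τ ^ (1 - p) * τ ^ p := by rw [← Real.rpow_add hτ]; simp
    _ ≤ (2 ^ (-m : ℝ)) ^ (1 - p) * τ ^ p := by
      gcongr
    _ = 2 ^ (-m * (1 - p) : ℝ) * τ ^ p := by rw [← Real.rpow_mul two_pos.le]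
    _ ≤ 2 ^ (((m : ℝ) - N k) * p) * τ ^ p := by
      refine mul_le_mul_of_nonneg_right
        (Real.rpow_le_rpow_of_exponent_le one_le_two ?_) (by positivity)
      have := mul_le_numDigits h k
      simp only [m]
      linarith
    _ = ((2 : ℝ) ^ m / 2 ^ N k * τ) ^ p := by
      rw [hm, Real.mul_rpow (by positivity) hτ.le, ← Real.rpow_mul two_pos.le]

theorem IsSparseScale.eventually_lastDigit_le (h : IsSparseScale p N) (hp : 0 ≤ p) {ε : ℝ}
    (hε : 0 < ε) : ∀ᶠ k in atTop, (lastDigit p N k : ℝ) ≤ (p + ε) * N k := by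
  rw [← map_add_atTop_eq_nat 1, eventually_map]
  have hN : Tendsto (fun k => ε / 2 * (N (k + 1) : ℝ)) atTop atTop :=
    (tendsto_natCast_atTop_atTop.comp (h.tendsto.comp (tendsto_add_atTop_nat 1))).const_mul_atTop
      (half_pos hε)
  filter_upwards [h.eventually_le (ε / 2) (half_pos hε), hN.eventually_ge_atTop 1] with k h1 h2
  have h3 := (Nat.ceil_lt_add_one (show 0 ≤ p * (N (k + 1) : ℝ) by positivity)).le
  rw [lastDigit]
  push_cast
  linarith

theorem exists_abs_sub_le_of_mem_sparseSet {x : ℝ} (hx : x ∈ sparseSet p N) (k : ℕ) :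
    ∃ i : ℤ, |x - i / 2 ^ lastDigit p N k| ≤ 2 ^ (-N k : ℝ) := by
  obtain ⟨i, hi⟩ := hx.2 k
  refine ⟨i, ?_⟩
  rw [Real.rpow_neg two_pos.le, Real.rpow_natCast, abs_of_nonneg (by linarith [hi.1])]
  linarith [hi.2]

theorem abs_le_one_of_mem_sparseSet {x : ℝ} (hx : x ∈ sparseSet p N) : |x| ≤ 1 :=
  abs_le.2 ⟨by linarith [hx.1.1], hx.1.2⟩

theorem boxDimLE_sparseSet (h : IsSparseScale p N) (hp : 0 ≤ p) :
    BoxDimLE N (sparseSet p N) p :=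
  boxDimLE_of_lattice h.tendsto (C := 1) (fun _ hx => abs_le_one_of_mem_sparseSet hx)
    (lastDigit p N)
    (fun _ hx k => by simpa using exists_abs_sub_le_of_mem_sparseSet hx k)
    fun _ hε => h.eventually_lastDigit_le hp hε

end spread

/-! ### Shears of sparse sets, and existence of sparse scales. -/

/-- Projecting a product of sparse sets in a direction from a sparse set does not increase the
dimension of the first factor, since the product of the two finer lattices refines the first. -/
theorem boxDimLE_sub_mul_sparseSet {N : ℕ → ℕ} {q e : ℝ} (hq0 : 0 ≤ q) (he0 : 0 ≤ e)
    (hq : IsSparseScale q N) (he : IsSparseScale e N) (hqe : IsSparseScale (q + e) N)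
    {v : ℝ} (hv : v ∈ sparseSet e N) :
    BoxDimLE N (image2 (fun y z => y - v * z) (sparseSet (q + e) N) (sparseSet q N)) (q + e) := by
  -- The error is `η` from `y`, `η` from `v` and `2η` from `z`, as the approximation of `v` has size
  -- at most `2`. The maximum of exponents is a common denominator for both lattice terms.
  refine boxDimLE_of_lattice hqe.tendsto (B := 2) (C := 4) ?_
    (fun k => max (lastDigit (q + e) N k) (lastDigit q N k + lastDigit e N k)) ?_ ?_
  · rintro _ ⟨y, hy, z, hz, rfl⟩
    have h1 := abs_le_one_of_mem_sparseSet hy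
    have h2 := abs_le_one_of_mem_sparseSet hz
    have h3 := abs_le_one_of_mem_sparseSet hv
    have h4 : |v * z| ≤ 1 := by rw [abs_mul]; exact mul_le_one₀ h3 (abs_nonneg _) h2
    linarith [abs_sub y (v * z)]
  · rintro _ ⟨y, hy, z, hz, rfl⟩ k
    obtain ⟨i, hi⟩ := exists_abs_sub_le_of_mem_sparseSet hy k
    obtain ⟨j, hj⟩ := exists_abs_sub_le_of_mem_sparseSet hz k
    obtain ⟨l, hl⟩ := exists_abs_sub_le_of_mem_sparseSet hv k
    have hv1 := abs_le_one_of_mem_sparseSet hv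
    have hz1 := abs_le_one_of_mem_sparseSet hz
    set a := lastDigit (q + e) N k
    set b := lastDigit q N k
    set c := lastDigit e N k
    set η : ℝ := 2 ^ (-N k : ℝ)
    have hη1 : η ≤ 1 := Real.rpow_le_one_of_one_le_of_nonpos one_le_two (by simp)
    have hη0 : 0 ≤ η := by positivity
    refine ⟨i * 2 ^ (max a (b + c) - a) - l * j * 2 ^ (max a (b + c) - (b + c)), ?_⟩
    have e1 : (i : ℝ) / 2 ^ a = i * 2 ^ (max a (b + c) - a) / 2 ^ max a (b + c) := by
      rw [div_eq_div_iff (by positivity) (by positivity), mul_assoc, ← pow_add,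
        Nat.sub_add_cancel (le_max_left _ _)]
    have e2 : (l : ℝ) / 2 ^ c * (j / 2 ^ b) =
        l * j * 2 ^ (max a (b + c) - (b + c)) / 2 ^ max a (b + c) := by
      rw [div_mul_div_comm, ← pow_add, add_comm c b,
        div_eq_div_iff (by positivity) (by positivity), mul_assoc (l * j : ℝ), ← pow_add,
        Nat.sub_add_cancel (le_max_right _ _)]
    push_cast
    rw [sub_div, ← e1, ← e2]
    set z0 : ℝ := j / 2 ^ b
    set v0 : ℝ := l / 2 ^ c
    have hv0 : |v0| ≤ 2 := by
      have := abs_sub_abs_le_abs_sub v0 v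
      rw [abs_sub_comm v0 v] at this
      linarith
    have h5 : |(v - v0) * z| ≤ η := by
      rw [abs_mul]
      exact (mul_le_of_le_one_right (abs_nonneg _) hz1).trans hl
    have h6 : |v0 * (z - z0)| ≤ 2 * η := by
      rw [abs_mul]
      exact mul_le_mul hv0 hj (abs_nonneg _) zero_le_two
    have h7 : y - v * z - (i / 2 ^ a - v0 * z0) =
        (y - i / 2 ^ a) - ((v - v0) * z + v0 * (z - z0)) := by ring
    rw [h7]
    linarith [abs_sub (y - i / 2 ^ a) ((v - v0) * z + v0 * (z - z0)),
      abs_add_le ((v - v0) * z) (v0 * (z - z0))]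
  · intro ε hε
    filter_upwards [hqe.eventually_lastDigit_le (add_nonneg hq0 he0) hε,
      hq.eventually_lastDigit_le hq0 (half_pos hε),
      he.eventually_lastDigit_le he0 (half_pos hε)] with k h1 h2 h3
    rw [Nat.cast_max, Nat.cast_add]
    exact max_le h1 (by linarith)

/-- Factorially growing scales are sparse. -/
theorem eventually_isSparseScale {p : ℝ} (hp0 : 0 ≤ p) (hp : p < 1) :
    ∀ᶠ K in atTop, IsSparseScale p fun k => k * (k + K).factorial := by
  have h1 : Tendsto (fun K : ℕ => (1 - p) * (K : ℝ)) atTop atTop :=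
    tendsto_natCast_atTop_atTop.const_mul_atTop (by linarith)
  filter_upwards [h1.eventually_ge_atTop 3] with K hK
  -- The factor `k` forces `N 0 = 0`, and the factorial makes `N (k + 1)` at least `(k + 1 + K) * N
  -- k`.
  set N : ℕ → ℕ := fun k => k * (k + K).factorial with hN
  have hstep : ∀ k, N k * (k + 1 + K) ≤ N (k + 1) := by
    intro k
    simp only [hN]
    rw [show k + 1 + K = (k + K) + 1 by ring, Nat.factorial_succ]
    calc k * (k + K).factorial * (k + K + 1) = k * ((k + K + 1) * (k + K).factorial) := by ring
      _ ≤ _ := Nat.mul_le_mul_right _ (Nat.le_succ k)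
  have hstep' : ∀ k, (N k : ℝ) * (k + 1 + K) ≤ N (k + 1) := fun k => by exact_mod_cast hstep k
  have hlow : ∀ k, (K + 1 : ℝ) ≤ N (k + 1) := by
    intro k
    have h2 : K + 1 ≤ N (k + 1) :=
      calc K + 1 ≤ k + 1 + K := by omega
        _ ≤ (k + 1 + K).factorial := Nat.self_le_factorial _
        _ ≤ N (k + 1) := Nat.le_mul_of_pos_left _ k.succ_pos
    exact_mod_cast h2
  refine ⟨by simp [hN], fun k => ?_, fun ε hε => ?_⟩
  · have h3 := Nat.ceil_lt_add_one (show 0 ≤ p * (N (k + 1) : ℝ) by positivity)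
    have h4 := hstep' k
    have h5 := hlow k
    have hK0 : (0 : ℝ) ≤ K := Nat.cast_nonneg K
    have h6 : (N k : ℝ) * (K + 1) ≤ N (k + 1) :=
      le_trans (mul_le_mul_of_nonneg_left (by linarith [(Nat.cast_nonneg k : (0 : ℝ) ≤ k)])
        (Nat.cast_nonneg _)) h4
    have h7 : (N k : ℝ) + p * N (k + 1) + 2 ≤ N (k + 1) := by
      -- After multiplying by `K + 1`, the terms `N k` and `2` cost at most `3 * N (k + 1)`, hence
      -- the threshold `3` for `(1 - p) * K`.
      have h8 : ((N k : ℝ) + p * N (k + 1) + 2) * (K + 1) ≤ N (k + 1) * (K + 1) := by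
        nlinarith [mul_le_mul_of_nonneg_right
          (show (3 : ℝ) ≤ (1 - p) * (K + 1) by nlinarith) (Nat.cast_nonneg (α := ℝ) (N (k + 1)))]
      exact le_of_mul_le_mul_right h8 (by positivity)
    have h9 : ((N k + ⌈p * (N (k + 1) : ℝ)⌉₊ + 1 : ℕ) : ℝ) ≤ N (k + 1) := by
      push_cast
      linarith
    exact_mod_cast h9
  · have h2 : Tendsto (fun k : ℕ => ε * (k : ℝ)) atTop atTop :=
      tendsto_natCast_atTop_atTop.const_mul_atTop hε
    filter_upwards [h2.eventually_ge_atTop 1] with k hk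
    have h3 := hstep' k
    have h4 : (1 : ℝ) ≤ ε * (k + 1 + K) := by
      nlinarith [(Nat.cast_nonneg K : (0 : ℝ) ≤ K)]
    calc (N k : ℝ) = N k * 1 := (mul_one _).symm
      _ ≤ N k * (ε * (k + 1 + K)) := by gcongr
      _ = ε * (N k * (k + 1 + K)) := by ring
      _ ≤ ε * N (k + 1) := by gcongr

/-! ### A chart of the Grassmannian and the product construction. -/

/-- Coordinates on Euclidean space `ℝ³`. -/
noncomputable def coordEquiv : (ℝ × ℝ × ℝ) ≃L[ℝ] EuclideanSpace ℝ (Fin 3) :=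
  LinearEquiv.toContinuousLinearEquiv
    { toFun := fun q => !₂[q.1, q.2.1, q.2.2]
      invFun := fun x => (x 0, x 1, x 2)
      map_add' := fun a b => by ext i; fin_cases i <;> simp
      map_smul' := fun c a => by ext i; fin_cases i <;> simp
      left_inv := fun a => by simp
      right_inv := fun x => by ext i; fin_cases i <;> simp }

theorem coordEquiv_apply (q : ℝ × ℝ × ℝ) : coordEquiv q = !₂[q.1, q.2.1, q.2.2] := rfl

theorem coordEquiv_ne_zero (u v : ℝ) : coordEquiv (u, v, 1) ≠ 0 := by
  intro h
  have := congrArg (fun x : EuclideanSpace ℝ (Fin 3) => x 2) h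
  simp [coordEquiv_apply] at this

/-- The plane orthogonal to `(u, v, 1)`. -/
noncomputable def orthPlane (q : ℝ × ℝ) : RealGrassmannian 2 3 :=
  ⟨(ℝ ∙ coordEquiv (q.1, q.2, 1))ᗮ, by
    have : Fact (Module.finrank ℝ (EuclideanSpace ℝ (Fin 3)) = 2 + 1) := ⟨by simp⟩
    exact Submodule.finrank_orthogonal_span_singleton (coordEquiv_ne_zero _ _)⟩

theorem proj_orthPlane_self (q : ℝ × ℝ) :
    (orthPlane q).proj (coordEquiv (q.1, q.2, 1)) = 0 :=
  Submodule.starProjection_orthogonalComplement_singleton_eq_zero _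

theorem proj_orthPlane_coordEquiv (u v x y z : ℝ) :
    (orthPlane (u, v)).proj (coordEquiv (x, y, z)) =
      (orthPlane (u, v)).proj (coordEquiv (x - u * z, y - v * z, 0)) := by
  have h : ((x, y, z) : ℝ × ℝ × ℝ) = (x - u * z, y - v * z, 0) + z • (u, v, 1) := by
    ext <;> simp [mul_comm z]
  have h2 := proj_orthPlane_self (u, v)
  rw [h, map_add, map_add, map_smul, map_smul, h2, smul_zero, add_zero]

/-- The normal `w` of the first plane is killed by its own projection, so the second projection
sends it to a vector `w - c • w'` of norm at most `2 * dist`. Its last coordinate bounds `|1 - c|`,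
and then the other two bound the coordinate differences, losing another factor `2`. -/
theorem dist_le_dist_orthPlane {q r : ℝ × ℝ} (hq : q ∈ Icc (-1 : ℝ) 1 ×ˢ Icc (-1 : ℝ) 1)
    (hr : r ∈ Icc (-1 : ℝ) 1 ×ˢ Icc (-1 : ℝ) 1) :
    dist q r ≤ 4 * dist (orthPlane q) (orthPlane r) := by
  obtain ⟨u, v⟩ := q
  obtain ⟨u', v'⟩ := r
  obtain ⟨⟨hu1, hu2⟩, hv1, hv2⟩ := hq
  obtain ⟨⟨hu1', hu2'⟩, hv1', hv2'⟩ := hr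
  simp only at hu1 hu2 hv1 hv2 hu1' hu2' hv1' hv2'
  set w := coordEquiv (u, v, 1) with hw
  set w' := coordEquiv (u', v', 1) with hw'
  have hwn : ‖w‖ ≤ 2 := by
    rw [hw, coordEquiv_apply, EuclideanSpace.norm_eq, Real.sqrt_le_left zero_le_two,
      Fin.sum_univ_three]
    simp
    nlinarith
  have hdist : ‖(orthPlane (u', v')).proj w‖ ≤ dist (orthPlane (u, v)) (orthPlane (u', v')) * 2 := by
    have h1 := ((orthPlane (u, v)).proj - (orthPlane (u', v')).proj).le_opNorm w
    have h2 : (orthPlane (u, v)).proj w = 0 := proj_orthPlane_self (u, v)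
    rw [sub_apply, h2, zero_sub, norm_neg, ← RealGrassmannian.dist_eq] at h1
    exact h1.trans (mul_le_mul_of_nonneg_left hwn dist_nonneg)
  obtain ⟨c, hc⟩ : ∃ c : ℝ, (orthPlane (u', v')).proj w = w - c • w' := by
    obtain ⟨c, hc⟩ := Submodule.mem_span_singleton.1
      (Submodule.starProjection_apply_mem (ℝ ∙ w') w)
    refine ⟨c, ?_⟩
    rw [hc]
    change (ℝ ∙ w')ᗮ.starProjection w = _
    rw [Submodule.starProjection_orthogonal']
    rfl
  rw [hc] at hdist
  have hcoord : ∀ i, |(w - c • w') i| ≤ ‖w - c • w'‖ := fun i => by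
    rw [← Real.norm_eq_abs]; exact PiLp.norm_apply_le (w - c • w') i
  generalize ‖w - c • w'‖ = D at hdist hcoord
  have h0 := hcoord 0
  have h1 := hcoord 1
  have h2 := hcoord 2
  simp [hw, hw', coordEquiv_apply] at h0 h1 h2
  have hx : ∀ a b : ℝ, -1 ≤ b → b ≤ 1 → |a - c * b| ≤ D → |a - b| ≤ 2 * D := by
    intro a b hb1 hb2 h
    have h3 : |(1 - c) * b| ≤ D := by
      rw [abs_mul]
      exact (mul_le_of_le_one_right (abs_nonneg _) (abs_le.2 ⟨hb1, hb2⟩)).trans h2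
    rw [abs_le] at h h3 ⊢
    constructor <;> linarith
  rw [Prod.dist_eq, Real.dist_eq, Real.dist_eq]
  have := hx u u' hu1' hu2' h0
  have := hx v v' hv1' hv2' h1
  refine max_le ?_ ?_ <;> simp only <;> linarith

theorem dimH_le_dimH_image_orthPlane {Q : Set (ℝ × ℝ)}
    (hQ : Q ⊆ Icc (-1 : ℝ) 1 ×ˢ Icc (-1 : ℝ) 1) : dimH Q ≤ dimH (orthPlane '' Q) := by
  have h : AntilipschitzWith 4 (fun q : Q => orthPlane q) :=
    AntilipschitzWith.of_le_mul_dist fun q r => dist_le_dist_orthPlane (hQ q.2) (hQ r.2)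
  have h1 := h.le_dimH_image univ
  rw [image_univ, ← (isometry_subtype_coe (s := Q)).dimH_image univ, image_univ,
    Subtype.range_coe] at h1
  rwa [image_eq_range]

/-- Lower bound for the size of the exceptional set of a product of three subsets of the line, for
the planes orthogonal to `(u, v, 1)` with `u ∈ U` and `v ∈ W`. -/
theorem le_exceptionalDim_of_prod {N : ℕ → ℕ} (hN : Tendsto N atTop atTop)
    {X Y Z U W : Set ℝ} {x y z x' y' d e s : ℝ}
    (hx : 0 ≤ x) (hy : 0 ≤ y) (hz : 0 ≤ z) (hd : 0 ≤ d) (he : 0 ≤ e)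
    (hxy' : 0 ≤ x' + y') (hs : x' + y' < s)
    (mX : MeasurableSet X) (mY : MeasurableSet Y) (mZ : MeasurableSet Z)
    (cX : HasHolderChart x X) (cY : HasHolderChart y Y) (cZ : HasHolderChart z Z)
    (bX : BoxDimLE N X x) (bY : BoxDimLE N Y y) (bZ : BoxDimLE N Z z)
    (cU : HasHolderChart d U) (cW : HasHolderChart e W)
    (hU : U ⊆ Icc (-1) 1) (hW : W ⊆ Icc (-1) 1)
    (bXZ : ∀ u ∈ U, BoxDimLE N (image2 (fun a c => a - u * c) X Z) x')
    (bYZ : ∀ v ∈ W, BoxDimLE N (image2 (fun b c => b - v * c) Y Z) y') :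
    ENNReal.ofReal (d + e) ≤ exceptionalDim 2 3 (x + y + z) s := by
  have hdim : dimH (coordEquiv '' (X ×ˢ Y ×ˢ Z)) = ENNReal.ofReal (x + y + z) := by
    rw [ContinuousLinearEquiv.dimH_image, add_assoc]
    refine le_antisymm ((bX.prod (bY.prod bZ)).dimH_le hN (by positivity)) ?_
    rw [ENNReal.ofReal_add hx (by positivity), ENNReal.ofReal_add hy hz]
    calc _ ≤ ENNReal.ofReal x + (ENNReal.ofReal y + dimH Z) := by gcongr; exact cZ.le_dimH hz
      _ ≤ ENNReal.ofReal x + dimH (Y ×ˢ Z) := by gcongr; exact cY.add_dimH_le hy cZ.nonempty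
      _ ≤ _ := cX.add_dimH_le hx (cY.nonempty.prod cZ.nonempty)
  have hmeas : MeasurableSet (coordEquiv '' (X ×ˢ Y ×ˢ Z)) :=
    coordEquiv.toHomeomorph.measurableEmbedding.measurableSet_image.2 (mX.prod (mY.prod mZ))
  have hsub : orthPlane '' (U ×ˢ W) ⊆ exceptionalSet 2 3 s (coordEquiv '' (X ×ˢ Y ×ˢ Z)) := by
    rintro _ ⟨⟨u, v⟩, ⟨hu, hv⟩, rfl⟩
    -- Sliding along the normal until the last coordinate is `0` does not change the projection, so
    -- this box in a coordinate plane controls it.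
    set R := image2 (fun a c => a - u * c) X Z ×ˢ image2 (fun b c => b - v * c) Y Z ×ˢ ({0} : Set ℝ)
    have hR : dimH R ≤ ENNReal.ofReal (x' + y') := by
      have := ((bXZ u hu).prod ((bYZ v hv).prod boxDimLE_singleton)).dimH_le hN (by linarith)
      simpa using this
    have himg : (orthPlane (u, v)).proj '' (coordEquiv '' (X ×ˢ Y ×ˢ Z)) ⊆
        (orthPlane (u, v)).proj '' (coordEquiv '' R) := by
      rintro _ ⟨_, ⟨⟨a, b, c⟩, ⟨ha, hb, hc⟩, rfl⟩, rfl⟩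
      rw [proj_orthPlane_coordEquiv]
      exact mem_image_of_mem _ (mem_image_of_mem _ ⟨⟨a, ha, c, hc, rfl⟩, ⟨b, hb, c, hc, rfl⟩, rfl⟩)
    calc dimH ((orthPlane (u, v)).proj '' (coordEquiv '' (X ×ˢ Y ×ˢ Z)))
        ≤ dimH (coordEquiv '' R) :=
          (dimH_mono himg).trans ((orthPlane (u, v)).proj.lipschitz.dimH_image_le _)
      _ = dimH R := ContinuousLinearEquiv.dimH_image _ _
      _ ≤ ENNReal.ofReal (x' + y') := hR
      _ < ENNReal.ofReal s := ENNReal.ofReal_lt_ofReal_iff_of_nonneg hxy' |>.2 hs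
  calc ENNReal.ofReal (d + e) = ENNReal.ofReal d + ENNReal.ofReal e := ENNReal.ofReal_add hd he
    _ ≤ ENNReal.ofReal d + dimH W := by gcongr; exact cW.le_dimH he
    _ ≤ dimH (U ×ˢ W) := cU.add_dimH_le hd cW.nonempty
    _ ≤ dimH (orthPlane '' (U ×ˢ W)) := dimH_le_dimH_image_orthPlane (prod_mono hU hW)
    _ ≤ dimH (exceptionalSet 2 3 s (coordEquiv '' (X ×ˢ Y ×ˢ Z))) := dimH_mono hsub
    _ ≤ exceptionalDim 2 3 (x + y + z) s :=
      le_iSup_of_le _ (le_iSup_of_le hmeas (le_iSup_of_le hdim le_rfl))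

theorem image2_sub_zero_mul_subset (X Z : Set ℝ) :
    image2 (fun a c => a - (0 : ℝ) * c) X Z ⊆ X := by
  rintro _ ⟨a, ha, c, _, rfl⟩
  simpa using ha

theorem boxDimLE_image2_sub_mul {N : ℕ → ℕ} (hN : Tendsto N atTop atTop) {X Z : Set ℝ}
    (hX : X ⊆ Icc (-1) 1) (hZ : Z ⊆ Icc (-1) 1) {u : ℝ} (hu : u ∈ Icc (-1 : ℝ) 1) :
    BoxDimLE N (image2 (fun a c => a - u * c) X Z) 1 := by
  refine (boxDimLE_Icc hN (-2) 2).mono_set ?_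
  rintro _ ⟨a, ha, c, hc, rfl⟩
  have h1 : |u * c| ≤ 1 := by
    rw [abs_mul]
    exact mul_le_one₀ (abs_le.2 hu) (abs_nonneg _) (abs_le.2 (hZ hc))
  have h2 := abs_le.1 h1
  have h3 := hX ha
  constructor <;> simp only <;> linarith [h3.1, h3.2]

theorem sparseSet_subset_Icc (p : ℝ) (N : ℕ → ℕ) : sparseSet p N ⊆ Icc (-1) 1 :=
  fun _ hx => abs_le.1 (abs_le_one_of_mem_sparseSet hx)

theorem Icc_zero_one_subset : Icc (0 : ℝ) 1 ⊆ Icc (-1) 1 := Icc_subset_Icc_left (by norm_num)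

theorem singleton_zero_subset : ({0} : Set ℝ) ⊆ Icc (-1) 1 := by simp

/-! ### The examples, and passage to the limit. -/

/-- Common sparse scales for three exponents. -/
theorem exists_isSparseScale {p q r : ℝ} (hp : 0 ≤ p) (hp1 : p < 1) (hq : 0 ≤ q) (hq1 : q < 1)
    (hr : 0 ≤ r) (hr1 : r < 1) :
    ∃ N, IsSparseScale p N ∧ IsSparseScale q N ∧ IsSparseScale r N :=
  let ⟨_, h1, h2, h3⟩ := ((eventually_isSparseScale hp hp1).and
    ((eventually_isSparseScale hq hq1).and (eventually_isSparseScale hr hr1))).exists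
  ⟨_, h1, h2, h3⟩

/-- For every exponent in `(0, 1]` there is a Borel set in `[0, 1]` of exactly that dimension. -/
theorem exists_set_of_dim {p : ℝ} (hp : 0 < p) (hp1 : p ≤ 1) :
    ∃ (N : ℕ → ℕ) (S : Set ℝ), Tendsto N atTop atTop ∧ MeasurableSet S ∧ S ⊆ Icc (-1) 1 ∧
      HasHolderChart p S ∧ BoxDimLE N S p := by
  rcases hp1.lt_or_eq with h | rfl
  · obtain ⟨N, hN, -⟩ := exists_isSparseScale hp.le h hp.le h hp.le h
    exact ⟨N, sparseSet p N, hN.tendsto, measurableSet_sparseSet p N, sparseSet_subset_Icc p N,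
      hasHolderChart_sparseSet hN hp hp1, boxDimLE_sparseSet hN hp.le⟩
  · exact ⟨id, Icc 0 1, tendsto_id, measurableSet_Icc, Icc_zero_one_subset, hasHolderChart_Icc,
      boxDimLE_Icc tendsto_id 0 1⟩

/-- A set in the plane `x = 0` projects into a line, of dimension `1 < s`, for every plane with `u =
0`; these form a one-parameter family. -/
theorem one_le_exceptionalDim_of_le_two {a s : ℝ} (ha : 1 < a) (ha2 : a ≤ 2) (hs : 1 < s) :
    1 ≤ exceptionalDim 2 3 a s := by
  obtain ⟨N, S, hN, mS, hS, cS, bS⟩ := exists_set_of_dim (p := a - 1) (by linarith) (by linarith)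
  have := le_exceptionalDim_of_prod hN (X := {0}) (Y := Icc 0 1) (Z := S) (U := {0})
    (W := Icc 0 1) (x' := 0) (y' := 1) (s := s) le_rfl zero_le_one (by linarith) le_rfl zero_le_one
    (by norm_num) (by linarith) (measurableSet_singleton 0) measurableSet_Icc mS
    (hasHolderChart_singleton 0) hasHolderChart_Icc cS boxDimLE_singleton (boxDimLE_Icc hN 0 1) bS
    (hasHolderChart_singleton 0) hasHolderChart_Icc singleton_zero_subset Icc_zero_one_subset
    (by rintro u rfl; exact boxDimLE_singleton.mono_set (image2_sub_zero_mul_subset _ _))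
    (fun v hv => boxDimLE_image2_sub_mul hN Icc_zero_one_subset hS (Icc_zero_one_subset hv))
  simpa using this

/-- With `u = 0` the square `Y × Z` collapses to a segment while `X` is untouched, so the projection
has dimension at most `a - 1 < s`. -/
theorem one_le_exceptionalDim_of_two_lt {a s : ℝ} (ha : 2 < a) (ha3 : a ≤ 3) (hs : a - 1 < s) :
    1 ≤ exceptionalDim 2 3 a s := by
  obtain ⟨N, S, hN, mS, hS, cS, bS⟩ := exists_set_of_dim (p := a - 2) (by linarith) (by linarith)
  have := le_exceptionalDim_of_prod hN (X := S) (Y := Icc 0 1) (Z := Icc 0 1) (U := {0})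
    (W := Icc 0 1) (x' := a - 2) (y' := 1) (s := s) (by linarith) zero_le_one zero_le_one le_rfl
    zero_le_one (by linarith) (by linarith) mS measurableSet_Icc measurableSet_Icc
    cS hasHolderChart_Icc hasHolderChart_Icc bS (boxDimLE_Icc hN 0 1) (boxDimLE_Icc hN 0 1)
    (hasHolderChart_singleton 0) hasHolderChart_Icc singleton_zero_subset Icc_zero_one_subset
    (by rintro u rfl; exact bS.mono_set (image2_sub_zero_mul_subset _ _))
    (fun v hv => boxDimLE_image2_sub_mul hN Icc_zero_one_subset Icc_zero_one_subset
      (Icc_zero_one_subset hv))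
  have h2 : a - 2 + 1 + 1 = a := by ring
  rw [h2] at this
  simpa using this

/-- Given `b / 2 < t < min 1 b`, sparse sets of dimensions `t`, `b - t` and `2 t - b`: the product
of the first two projects to dimension `t` in all directions from the third. -/
theorem exists_planar_example {b t : ℝ} (hbt : b / 2 < t) (ht : t < 1) (htb : t < b) :
    ∃ (N : ℕ → ℕ) (Y Z W : Set ℝ), Tendsto N atTop atTop ∧ MeasurableSet Y ∧ MeasurableSet Z ∧
      Z ⊆ Icc (-1) 1 ∧ W ⊆ Icc (-1) 1 ∧
      HasHolderChart t Y ∧ HasHolderChart (b - t) Z ∧ HasHolderChart (2 * t - b) W ∧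
      BoxDimLE N Y t ∧ BoxDimLE N Z (b - t) ∧
      ∀ v ∈ W, BoxDimLE N (image2 (fun y z => y - v * z) Y Z) t := by
  obtain ⟨N, h1, h2, h3⟩ := exists_isSparseScale (p := t) (q := b - t) (r := 2 * t - b)
    (by linarith) ht (by linarith) (by linarith) (by linarith) (by linarith)
  -- This identity dictates the dimension of the set of directions.
  have e : b - t + (2 * t - b) = t := by ring
  refine ⟨N, sparseSet t N, sparseSet (b - t) N, sparseSet (2 * t - b) N, h1.tendsto,
    measurableSet_sparseSet _ _, measurableSet_sparseSet _ _, sparseSet_subset_Icc _ _,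
    sparseSet_subset_Icc _ _, hasHolderChart_sparseSet h1 (by linarith) ht.le,
    hasHolderChart_sparseSet h2 (by linarith) (by linarith),
    hasHolderChart_sparseSet h3 (by linarith) (by linarith), boxDimLE_sparseSet h1 (by linarith),
    boxDimLE_sparseSet h2 (by linarith), fun v hv => ?_⟩
  have := boxDimLE_sub_mul_sparseSet (by linarith) (by linarith) h2 h3 (e.symm ▸ h1) hv
  rwa [e] at this

theorem le_exceptionalDim_of_planar {a s t : ℝ} (hat : a / 2 < t) (ht : t < 1)
    (hta : t < a) (hts : t < s) : ENNReal.ofReal (2 * t - a) ≤ exceptionalDim 2 3 a s := by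
  obtain ⟨N, Y, Z, W, hN, mY, mZ, -, hW, cY, cZ, cW, bY, bZ, bYZ⟩ :=
    exists_planar_example hat ht hta
  have := le_exceptionalDim_of_prod hN (X := {0}) (U := {0}) (x' := 0) (s := s) le_rfl
    (by linarith) (by linarith) le_rfl (by linarith) (by linarith) (by linarith)
    (measurableSet_singleton 0) mY mZ (hasHolderChart_singleton 0) cY cZ boxDimLE_singleton bY bZ
    (hasHolderChart_singleton 0) cW singleton_zero_subset hW
    (by rintro u rfl; exact boxDimLE_singleton.mono_set (image2_sub_zero_mul_subset _ _)) bYZ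
  simpa using this

/-- The planar example with `a - 1`, `t - 1`, times an interval: the new factor adds `1` to the
projection bound and, since every `u` is allowed, `1` to the directions, giving `1 + 2(t - 1) - (a -
1) = 2t - a`. -/
theorem le_exceptionalDim_of_spatial {a s t : ℝ} (hat : (a + 1) / 2 < t) (ht : t < 2)
    (hta : t < a) (hts : t < s) : ENNReal.ofReal (2 * t - a) ≤ exceptionalDim 2 3 a s := by
  obtain ⟨N, Y, Z, W, hN, mY, mZ, hZ, hW, cY, cZ, cW, bY, bZ, bYZ⟩ :=
    exists_planar_example (b := a - 1) (t := t - 1) (by linarith) (by linarith) (by linarith)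
  have := le_exceptionalDim_of_prod hN (X := Icc 0 1) (U := Icc 0 1) (x' := 1) (s := s) zero_le_one
    (by linarith) (by linarith) zero_le_one (by linarith) (by linarith) (by linarith)
    measurableSet_Icc mY mZ hasHolderChart_Icc cY cZ (boxDimLE_Icc hN 0 1) bY bZ
    hasHolderChart_Icc cW Icc_zero_one_subset hW
    (fun u hu => boxDimLE_image2_sub_mul hN Icc_zero_one_subset hZ (Icc_zero_one_subset hu)) bYZ
  convert this using 2 <;> ring

/-- The examples need `t < s`, as the exceptional set is defined by a strict inequality; the
supremum over sets absorbs the limit `t → s`. -/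
theorem ofReal_two_mul_sub_le {a s l : ℝ} {T : ℝ≥0∞} (hl : l < s)
    (h : ∀ t, l < t → t < s → ENNReal.ofReal (2 * t - a) ≤ T) : ENNReal.ofReal (2 * s - a) ≤ T := by
  refine le_of_tendsto (x := 𝓝[<] s) (f := fun t => ENNReal.ofReal (2 * t - a)) ?_ ?_
  · exact (ENNReal.continuous_ofReal.comp (by fun_prop : Continuous fun t : ℝ => 2 * t - a)).tendsto s
      |>.mono_left nhdsWithin_le_nhds
  · filter_upwards [Ioo_mem_nhdsLT hl] with t ht using h t ht.1 ht.2

theorem proposition6p5 (a s : ℝ) (hs : 0 < s) (hsa : s < min 2 a) :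
    (a ≤ 1 → ENNReal.ofReal (max 0 (2 * s - a)) ≤ exceptionalDim 2 3 a s) ∧
    (1 < a → a ≤ 2 →
      (s ≤ a / 2 → 0 ≤ exceptionalDim 2 3 a s) ∧
      (a / 2 < s → s ≤ 1 → ENNReal.ofReal (2 * s - a) ≤ exceptionalDim 2 3 a s) ∧
      (1 < s → s ≤ (a + 1) / 2 → 1 ≤ exceptionalDim 2 3 a s) ∧
      ((a + 1) / 2 < s → s < a → ENNReal.ofReal (2 * s - a) ≤ exceptionalDim 2 3 a s)) ∧
    (2 < a → a ≤ 3 →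
      (s ≤ a - 1 → 0 ≤ exceptionalDim 2 3 a s) ∧
      (a - 1 < s → s ≤ (a + 1) / 2 → 1 ≤ exceptionalDim 2 3 a s) ∧
      ((a + 1) / 2 < s → s < 2 → ENNReal.ofReal (2 * s - a) ≤ exceptionalDim 2 3 a s)) := by
  have hs2 : s < 2 := hsa.trans_le (min_le_left _ _)
  have hsa' : s < a := hsa.trans_le (min_le_right _ _)
  have planar (has : a / 2 < s) (hs1 : s ≤ 1) :
      ENNReal.ofReal (2 * s - a) ≤ exceptionalDim 2 3 a s :=
    ofReal_two_mul_sub_le has fun t h1 h2 =>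
      le_exceptionalDim_of_planar h1 (by linarith) (by linarith) h2
  have spatial (has : (a + 1) / 2 < s) :
      ENNReal.ofReal (2 * s - a) ≤ exceptionalDim 2 3 a s :=
    ofReal_two_mul_sub_le has fun t h1 h2 =>
      le_exceptionalDim_of_spatial h1 (by linarith) (by linarith) h2
  refine ⟨fun ha => ?_, fun ha1 ha2 => ⟨fun _ => zero_le, planar,
    fun h _ => one_le_exceptionalDim_of_le_two ha1 ha2 h, fun h _ => spatial h⟩,
    fun ha2 ha3 => ⟨fun _ => zero_le, fun h _ => one_le_exceptionalDim_of_two_lt ha2 ha3 h,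
      fun h _ => spatial h⟩⟩
  rcases le_or_gt s (a / 2) with h | h
  · rw [max_eq_left (by linarith)]
    simp
  · rw [max_eq_right (by linarith)]
    exact planar h (by linarith)
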